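/- Let $s,k,v,\ell$ be integers with $0\le s\le k\le v/2$ and $\ell\ge 0$, and let $V$ be a set with $v$ elements. Let $W_{sk}$ and $U_{sk}^{\ell}$ be the real matrices whose rows are indexed by the $s$-subsets $S$ of $V$ and whose columns are indexed by the $k$-subsets $K$ of $V$, with entries $$W_{sk}(S,K)=\begin{cases}1,& S\subseteq K,\\ 0,&\text{otherwise,}\end{cases}\qquad U_{sk}^{\ell}(S,K)=\begin{cases}1,& |S\cap K|=\ell,\\ 0,&\text{otherwise.}\end{cases}$$ For $j=0,1,\dots,s$ put $$\tau_j:=(-1)^{k+s+\ell}\sum_{i=\min(j,\ell)}^{k}(-1)^i\binom{i}{\ell}\binom{k-j}{i-j}\binom{v-j-i}{k-i}\binom{i-s-1}{k-s},$$ where $\binom{n}{m}=n(n-1)\cdots(n-m+1)/m!$ for integers $n$ and $m\ge 0$, and $\binom{n}{m}=0$ for $m<0$. Then the eigenvalues of the square matrix $W_{sk}^{\top}U_{sk}^{\ell}$, counted with multiplicity, are $$\tau_0^{\binom v0},\ \tau_1^{\binom v1-\binom v0},\ \dots,\ \tau_s^{\binom vs-\binom v{s-1}},\ 0^{\binom vk-\binom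 vs},$$ where the exponents indicate multiplicities, and the multiplicities of numbers in this list that coincide are added. This holds both for algebraic multiplicities (as roots of the characteristic polynomial) and for geometric multiplicities (dimensions of eigenspaces over $\mathbb R$). Moreover, $$\operatorname{rank} U_{sk}^{\ell}=\sum_{\substack{0\le j\le s\\ \tau_j\neq 0}}\left(\binom vj-\binom v{j-1}\right).$$ -/

import Mathlib

/-- The `s`-element subsets of `α`, used to index rows and columns. -/
abbrev SubsetsOfCard (α : Type*) (s : ℕ) : Type _ := {S : Finset α // S.card = s}

/-- The inclusion matrix `W_{sk}`: the entry at `(S, K)` is `1` if `S ⊆ K` and `0` otherwise. -/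
def inclusionMatrix (α : Type*) [DecidableEq α] (s k : ℕ) :
    Matrix (SubsetsOfCard α s) (SubsetsOfCard α k) ℝ :=
  Matrix.of fun S K => if S.1 ⊆ K.1 then 1 else 0

/-- The intersection matrix `U_{sk}^ℓ`: the entry at `(S, K)` is `1` if `|S ∩ K| = ℓ`
and `0` otherwise. -/
def intersectionMatrix (α : Type*) [DecidableEq α] (s k ℓ : ℕ) :
    Matrix (SubsetsOfCard α s) (SubsetsOfCard α k) ℝ :=
  Matrix.of fun S K => if (S.1 ∩ K.1).card = ℓ then 1 else 0

/-- The binomial coefficient `n (n - 1) ⋯ (n - m + 1) / m!` for arbitrary integers `n`, `m`,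
with value `0` for `m < 0`. -/
def intBinom (n m : ℤ) : ℤ :=
  if 0 ≤ m then Ring.choose n m.toNat else 0

/-- The number `τ_j`, with integer arguments in all binomial coefficients. -/
def tauValue (v s k ℓ j : ℕ) : ℤ :=
  (-1) ^ (k + s + ℓ) * ∑ i ∈ Finset.Icc (min j ℓ) k,
    (-1) ^ i * intBinom i ℓ * intBinom ((k : ℤ) - j) ((i : ℤ) - j) *
      intBinom ((v : ℤ) - j - i) ((k : ℤ) - i) * intBinom ((i : ℤ) - s - 1) ((k : ℤ) - s)

/-- The multiplicity `C(v, j) - C(v, j - 1)`, where `C(v, -1) = 0`. The subtraction does not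
truncate for `2 * j ≤ v`, see `levelMult_add`. -/
def levelMult (v : ℕ) : ℕ → ℕ
  | 0 => v.choose 0
  | j + 1 => v.choose (j + 1) - v.choose j

theorem levelMult_add (v j : ℕ) (h : 2 * (j + 1) ≤ v) :
    levelMult v (j + 1) + v.choose j = v.choose (j + 1) := by
  have := Nat.choose_le_succ_of_lt_half_left (r := j) (n := v) (by omega)
  simp only [levelMult]
  omega

open Matrix Finset

/-! Inclusion–exclusion writes `U_{sk}^ℓ` as a combination of the `W_{is}ᵀ W_{ik}` with `i ≤ s`.
Since `W_{sk}ᵀ W_{is}ᵀ` is a multiple of `W_{ik}ᵀ`, the product `W_{sk}ᵀ U_{sk}^ℓ` is a combination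
of the Gram matrices `W_{ik}ᵀ W_{ik}`, and it suffices to diagonalize these simultaneously.

Call a vector on `j`-subsets harmonic if every `W_{tj}` with `t < j` kills it. By
`inclusionMatrix_mul_transpose_mul`, the lifts `W_{jk}ᵀ Q` of harmonic `Q` are common eigenvectors,
and lifts from different levels are orthogonal. Rank-nullity supplies `levelMult v j` of them at
level `j`; these numbers telescope to `C(v, k)`, so the lifts form a basis
(`exists_johnson_diagonalization`).

The resulting eigenvalue is `τ_j` for `j ≤ s` and `0` above. Finally `W_{sk} W_{sk}ᵀ` is invertible,
so `U_{sk}^ℓ` and `W_{sk}ᵀ U_{sk}^ℓ` have equal rank. -/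

/-! ### Products of inclusion matrices -/

theorem sum_subsetsOfCard {α M : Type*} [Fintype α] [DecidableEq α] [AddCommMonoid M] (i : ℕ)
    (f : Finset α → M) :
    ∑ I : SubsetsOfCard α i, f I.1 = ∑ I ∈ powersetCard i univ, f I := by
  symm
  apply Finset.sum_subtype
  simp [mem_powersetCard]

theorem card_subsetsOfCard (α : Type*) [Fintype α] (i : ℕ) :
    Fintype.card (SubsetsOfCard α i) = (Fintype.card α).choose i := by
  simp

/-- The number of `i`-subsets between `J` and `K`. -/
theorem card_powersetCard_filter_between {α : Type*} [Fintype α] [DecidableEq α] {i : ℕ}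
    {J K : Finset α} (hJK : J ⊆ K) (hi : J.card ≤ i) :
    #{I ∈ powersetCard i univ | J ⊆ I ∧ I ⊆ K} = (K.card - J.card).choose (i - J.card) := by
  rw [← card_sdiff_of_subset hJK, ← card_powersetCard]
  refine card_bij' (fun I _ => I \ J) (fun I _ => I ∪ J) ?_ ?_ ?_ ?_
  · intro I hI
    simp only [mem_filter, mem_powersetCard, subset_univ, true_and] at hI
    rw [mem_powersetCard, card_sdiff_of_subset hI.2.1, hI.1]
    exact ⟨sdiff_subset_sdiff hI.2.2 le_rfl, rfl⟩
  · intro I hI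
    rw [mem_powersetCard] at hI
    have hd : Disjoint I J := disjoint_of_subset_left hI.1 sdiff_disjoint
    simp only [mem_filter, mem_powersetCard, subset_univ, true_and, card_union_of_disjoint hd,
      subset_union_right, union_subset_iff, hJK, and_true]
    exact ⟨by omega, hI.1.trans sdiff_subset⟩
  · intro I hI
    simp only [mem_filter] at hI
    exact sdiff_union_of_subset hI.2.1
  · intro I hI
    rw [mem_powersetCard] at hI
    have hd : Disjoint I J := disjoint_of_subset_left hI.1 sdiff_disjoint
    simp [union_sdiff_right, sdiff_eq_self_of_disjoint hd]

theorem sum_between_indicator {α : Type*} [Fintype α] [DecidableEq α] {i : ℕ}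
    (J K : Finset α) (hi : J.card ≤ i) :
    ∑ I : SubsetsOfCard α i, (if J ⊆ I.1 then (1 : ℝ) else 0) * (if I.1 ⊆ K then 1 else 0) =
      if J ⊆ K then ((K.card - J.card).choose (i - J.card) : ℝ) else 0 := by
  rw [sum_subsetsOfCard i (fun I => (if J ⊆ I then (1 : ℝ) else 0) * (if I ⊆ K then 1 else 0))]
  simp only [← ite_and, mul_ite, mul_one, mul_zero]
  split_ifs with h
  · rw [← card_powersetCard_filter_between h hi, card_eq_sum_ones, sum_filter]
    push_cast
    refine sum_congr rfl fun I _ => ?_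
    simp only [and_comm]
  · refine sum_eq_zero fun I _ => if_neg fun hI => h (hI.2.trans hI.1)

theorem inclusionMatrix_apply {α : Type*} [DecidableEq α] {s k : ℕ} (S : SubsetsOfCard α s) (K : SubsetsOfCard α k) :
    inclusionMatrix α s k S K = if S.1 ⊆ K.1 then 1 else 0 := rfl

theorem inclusionMatrix_eq_zero {α : Type*} [DecidableEq α] {s k : ℕ} (h : k < s) : inclusionMatrix α s k = 0 := by
  ext S K
  rw [inclusionMatrix_apply, if_neg]
  · rfl
  · intro hS
    have := card_le_card hS
    rw [S.2, K.2] at this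
    omega

theorem inclusionMatrix_self {α : Type*} [DecidableEq α] (s : ℕ) : inclusionMatrix α s s = 1 := by
  ext S K
  rw [inclusionMatrix_apply, Matrix.one_apply]
  congr 1
  rw [eq_iff_iff, Subtype.ext_iff]
  exact ⟨fun h => eq_of_subset_of_card_le h (by rw [S.2, K.2]), fun h => h.le⟩

section
variable {α : Type*} [Fintype α] [DecidableEq α]

theorem inclusionMatrix_mul {j i : ℕ} (k : ℕ) (hji : j ≤ i) :
    inclusionMatrix α j i * inclusionMatrix α i k =
      ((k - j).choose (i - j) : ℝ) • inclusionMatrix α j k := by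
  ext J K
  simp only [mul_apply, inclusionMatrix_apply, Matrix.smul_apply, smul_eq_mul]
  rw [sum_between_indicator J.1 K.1 (by rw [J.2]; exact hji), J.2, K.2]
  simp

theorem transpose_mul_inclusionMatrix_apply {t i j : ℕ} (I : SubsetsOfCard α i)
    (J : SubsetsOfCard α j) :
    ((inclusionMatrix α t i)ᵀ * inclusionMatrix α t j) I J = ((I.1 ∩ J.1).card.choose t : ℝ) := by
  simp only [mul_apply, transpose_apply, inclusionMatrix_apply]
  have h := sum_between_indicator (i := t) ∅ (I.1 ∩ J.1) (by simp)
  simp only [empty_subset, if_true, card_empty, Nat.sub_zero, one_mul] at h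
  rw [← h]
  refine sum_congr rfl fun T _ => ?_
  simp only [subset_inter_iff, ite_and]
  split_ifs <;> simp

theorem inclusionMatrix_mul_transpose_apply {i j k : ℕ} (hk : k ≤ Fintype.card α)
    (I : SubsetsOfCard α i) (J : SubsetsOfCard α j) :
    (inclusionMatrix α i k * (inclusionMatrix α j k)ᵀ) I J =
      ((Fintype.card α - (I.1 ∪ J.1).card).choose (Fintype.card α - k) : ℝ) := by
  simp only [mul_apply, transpose_apply, inclusionMatrix_apply]
  have hp : ∀ K : SubsetsOfCard α k,
      ((if I.1 ⊆ K.1 then (1 : ℝ) else 0) * if J.1 ⊆ K.1 then 1 else 0) =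
        if I.1 ∪ J.1 ⊆ K.1 then 1 else 0 := fun K => by
    simp only [union_subset_iff, ite_and]
    split_ifs <;> simp
  simp only [hp]
  have hu : (I.1 ∪ J.1).card ≤ Fintype.card α := card_le_univ _
  rcases le_or_gt (I.1 ∪ J.1).card k with h | h
  · have := sum_between_indicator (i := k) (I.1 ∪ J.1) univ h
    simp only [subset_univ, if_true, mul_one, card_univ] at this
    rw [this]
    congr 1
    rw [← Nat.choose_symm (by omega)]
    congr 1
    omega
  · rw [Nat.choose_eq_zero_of_lt (by omega), Nat.cast_zero]
    refine sum_eq_zero fun K _ => if_neg fun hK => ?_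
    have := card_le_card hK
    rw [K.2] at this
    omega

/-- The complement of `I ∪ J` has `|I ∩ J| + (v - i - j)` elements; Vandermonde splits the resulting
binomial coefficient, and `C(|I ∩ J|, t)` is an entry of `W_{ti}ᵀ W_{tj}`. -/
theorem inclusionMatrix_mul_transpose {i j k : ℕ} (hij : i + j ≤ Fintype.card α)
    (hk : k ≤ Fintype.card α) :
    inclusionMatrix α i k * (inclusionMatrix α j k)ᵀ =
      ∑ t ∈ range (Fintype.card α - k + 1),
        ((Fintype.card α - i - j).choose (Fintype.card α - k - t) : ℝ) •
          ((inclusionMatrix α t i)ᵀ * inclusionMatrix α t j) := by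
  ext I J
  rw [inclusionMatrix_mul_transpose_apply hk, Matrix.sum_apply]
  simp only [Matrix.smul_apply, transpose_mul_inclusionMatrix_apply, smul_eq_mul]
  have h1 := card_union_add_card_inter I.1 J.1
  have h2 := card_le_univ (I.1 ∪ J.1)
  rw [I.2, J.2] at h1
  have h3 : Fintype.card α - (I.1 ∪ J.1).card =
      (I.1 ∩ J.1).card + (Fintype.card α - i - j) := by omega
  rw [h3, Nat.add_choose_eq, Nat.sum_antidiagonal_eq_sum_range_succ_mk]
  push_cast
  exact sum_congr rfl fun t _ => mul_comm _ _

/-- On vectors annihilated by all lower inclusion matrices, `W_{ik} W_{jk}ᵀ` is a multiple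
of `W_{ji}ᵀ`. -/
theorem inclusionMatrix_mul_transpose_mul {ι : Type*} {i j k : ℕ}
    (hij : i + j ≤ Fintype.card α) (hjk : j + k ≤ Fintype.card α)
    {Q : Matrix (SubsetsOfCard α j) ι ℝ} (hQ : ∀ t < j, inclusionMatrix α t j * Q = 0) :
    inclusionMatrix α i k * ((inclusionMatrix α j k)ᵀ * Q) =
      ((Fintype.card α - i - j).choose (Fintype.card α - k - j) : ℝ) •
        ((inclusionMatrix α j i)ᵀ * Q) := by
  rw [← Matrix.mul_assoc, inclusionMatrix_mul_transpose hij (by omega), Matrix.sum_mul,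
    sum_eq_single j]
  · rw [inclusionMatrix_self, Matrix.mul_one, Matrix.smul_mul]
  · intro t _ ht
    rw [Matrix.smul_mul, Matrix.mul_assoc]
    rcases lt_or_gt_of_ne ht with h | h
    · rw [hQ t h, Matrix.mul_zero, smul_zero]
    · rw [inclusionMatrix_eq_zero h, Matrix.zero_mul, Matrix.mul_zero, smul_zero]
  · intro h
    rw [mem_range] at h
    omega

/-- The eigenvalue of `W_{ik}ᵀ W_{ik}` on the `j`-th eigenspace of the Johnson scheme. -/
def johnsonEigenvalue (v k i j : ℕ) : ℕ :=
  if j ≤ i then (k - j).choose (i - j) * (v - i - j).choose (k - i) else 0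

theorem gram_inclusionMatrix_mul {ι : Type*} {i j k : ℕ} (hik : i ≤ k) (hjk : j ≤ k)
    (hk : 2 * k ≤ Fintype.card α)
    {Q : Matrix (SubsetsOfCard α j) ι ℝ} (hQ : ∀ t < j, inclusionMatrix α t j * Q = 0) :
    (inclusionMatrix α i k)ᵀ * inclusionMatrix α i k * ((inclusionMatrix α j k)ᵀ * Q) =
      (johnsonEigenvalue (Fintype.card α) k i j : ℝ) • ((inclusionMatrix α j k)ᵀ * Q) := by
  rw [Matrix.mul_assoc, inclusionMatrix_mul_transpose_mul (by omega) (by omega) hQ,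
    Matrix.mul_smul, ← Matrix.mul_assoc, ← transpose_mul]
  unfold johnsonEigenvalue
  split_ifs with h
  · rw [inclusionMatrix_mul k h, transpose_smul, Matrix.smul_mul, smul_smul, mul_comm]
    push_cast
    congr 3
    rw [← Nat.choose_symm (by omega)]
    congr 1
    omega
  · rw [inclusionMatrix_eq_zero (by omega)]
    simp

/-- Gives orthogonality of lifts for `i < j`, where `W_{ji} = 0`, and their norms for `i = j`. -/
theorem transpose_mul_gram {ι κ : Type*} {i j k : ℕ} (hik : i ≤ k) (hjk : j ≤ k)
    (hk : 2 * k ≤ Fintype.card α) (P : Matrix (SubsetsOfCard α i) κ ℝ)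
    {Q : Matrix (SubsetsOfCard α j) ι ℝ} (hQ : ∀ t < j, inclusionMatrix α t j * Q = 0) :
    ((inclusionMatrix α i k)ᵀ * P)ᵀ * ((inclusionMatrix α j k)ᵀ * Q) =
      ((Fintype.card α - i - j).choose (Fintype.card α - k - j) : ℝ) •
        (Pᵀ * ((inclusionMatrix α j i)ᵀ * Q)) := by
  rw [transpose_mul, transpose_transpose, Matrix.mul_assoc,
    inclusionMatrix_mul_transpose_mul (by omega) (by omega) hQ, Matrix.mul_smul]

end

/-! ### Harmonic vectors and simultaneous diagonalization -/

/-- A wide matrix annihilates an orthonormal family of the size given by rank-nullity. -/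
theorem exists_orthonormal_mul_eq_zero {m n : Type*} [Fintype m] [Fintype n] [DecidableEq n]
    (M : Matrix m n ℝ) {d : ℕ} (h : d + Fintype.card m ≤ Fintype.card n) :
    ∃ Q : Matrix n (Fin d) ℝ, Qᵀ * Q = 1 ∧ M * Q = 0 := by
  let f : EuclideanSpace ℝ n →ₗ[ℝ] (m → ℝ) :=
    M.mulVecLin ∘ₗ (WithLp.linearEquiv 2 ℝ (n → ℝ)).toLinearMap
  have hf := f.finrank_range_add_finrank_ker
  have hr : Module.finrank ℝ (LinearMap.range f) ≤ Fintype.card m := by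
    simpa using (LinearMap.range f).finrank_le
  rw [finrank_euclideanSpace] at hf
  have hd : d ≤ Module.finrank ℝ (LinearMap.ker f) := by omega
  let b := stdOrthonormalBasis ℝ (LinearMap.ker f)
  refine ⟨Matrix.of fun x a => (b (Fin.castLE hd a) : EuclideanSpace ℝ n) x, ?_, ?_⟩
  · ext a a'
    have := orthonormal_iff_ite.mp b.orthonormal (Fin.castLE hd a') (Fin.castLE hd a)
    rw [Submodule.coe_inner, PiLp.inner_apply] at this
    simp only [mul_apply, transpose_apply, of_apply, Matrix.one_apply]
    simp only [RCLike.inner_apply, conj_trivial, (Fin.castLE_injective hd).eq_iff] at this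
    rw [this]
    simp only [eq_comm]
  · ext x a
    have := (b (Fin.castLE hd a)).2
    rw [LinearMap.mem_ker] at this
    exact congrFun this x

theorem sum_levelMult {v k : ℕ} (h : 2 * k ≤ v) :
    ∑ j ∈ range (k + 1), levelMult v j = v.choose k := by
  induction k with
  | zero => simp [levelMult]
  | succ k ih => rw [sum_range_succ, ih (by omega), add_comm, levelMult_add v k h]

theorem exists_harmonic {α : Type*} [Fintype α] [DecidableEq α] {j : ℕ}
    (hj : 2 * j ≤ Fintype.card α) :
    ∃ Q : Matrix (SubsetsOfCard α j) (Fin (levelMult (Fintype.card α) j)) ℝ,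
      Qᵀ * Q = 1 ∧ ∀ t < j, inclusionMatrix α t j * Q = 0 := by
  cases j with
  | zero =>
    obtain ⟨Q, hQ, -⟩ := exists_orthonormal_mul_eq_zero
      (0 : Matrix Empty (SubsetsOfCard α 0) ℝ) (d := levelMult (Fintype.card α) 0)
      (by rw [card_subsetsOfCard]; simp [levelMult])
    exact ⟨Q, hQ, by simp⟩
  | succ j =>
    obtain ⟨Q, hQ, h0⟩ := exists_orthonormal_mul_eq_zero (inclusionMatrix α j (j + 1))
      (d := levelMult (Fintype.card α) (j + 1))
      (by rw [card_subsetsOfCard, card_subsetsOfCard, levelMult_add _ _ hj])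
    -- Killing level `j` is enough: `W_{tj} W_{j,j+1}` is a nonzero multiple of `W_{t,j+1}`.
    refine ⟨Q, hQ, fun t ht => ?_⟩
    have h := congrArg (· * Q) (inclusionMatrix_mul (α := α) (j + 1) (Nat.le_of_lt_succ ht))
    simp only [Matrix.mul_assoc, h0, Matrix.mul_zero, Matrix.smul_mul] at h
    refine (smul_eq_zero.mp h.symm).resolve_left ?_
    exact_mod_cast (Nat.choose_pos (by omega)).ne'

/-- The matrices `W_{ik}ᵀ W_{ik}` are simultaneously diagonalizable, with the eigenvalues of the
Johnson scheme. -/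
theorem exists_johnson_diagonalization {α : Type*} [Fintype α] [DecidableEq α] {v k : ℕ}
    (hv : Fintype.card α = v) (hk : 2 * k ≤ v) :
    ∃ (e : (Σ j : Fin (k + 1), Fin (levelMult v j)) ≃ SubsetsOfCard α k)
      (P : Matrix (SubsetsOfCard α k) (SubsetsOfCard α k) ℝ), IsUnit P ∧
      ∀ i ≤ k, (inclusionMatrix α i k)ᵀ * inclusionMatrix α i k * P =
        P * diagonal fun K => (johnsonEigenvalue v k i (e.symm K).1 : ℝ) := by
  subst hv
  have hj : ∀ j : Fin (k + 1), 2 * (j : ℕ) ≤ Fintype.card α := fun j => by omega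
  choose Q hQ1 hQ0 using fun j => exists_harmonic (hj j)
  have hcard : Fintype.card (Σ j : Fin (k + 1), Fin (levelMult (Fintype.card α) j)) =
      Fintype.card (SubsetsOfCard α k) := by
    rw [card_subsetsOfCard, ← sum_levelMult hk, Fintype.card_sigma]
    simp only [Fintype.card_fin]
    exact Fin.sum_univ_eq_sum_range (fun j => levelMult (Fintype.card α) j) (k + 1)
  let e := Fintype.equivOfCardEq hcard
  let R : Matrix (SubsetsOfCard α k) (Σ j : Fin (k + 1), Fin (levelMult (Fintype.card α) j)) ℝ :=
    Matrix.of fun K x => ((inclusionMatrix α x.1 k)ᵀ * Q x.1) K x.2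
  have hR : Rᵀ * R = diagonal fun x =>
      ((Fintype.card α - x.1 - x.1).choose (Fintype.card α - k - x.1) : ℝ) := by
    have key : ∀ x y, (Rᵀ * R) x y = (((inclusionMatrix α x.1 k)ᵀ * Q x.1)ᵀ *
        ((inclusionMatrix α y.1 k)ᵀ * Q y.1)) x.2 y.2 := fun x y => rfl
    have hlt : ∀ x y : (Σ j : Fin (k + 1), Fin (levelMult (Fintype.card α) j)), x.1 < y.1 →
        (Rᵀ * R) x y = 0 := fun x y h => by
      rw [key, transpose_mul_gram (by omega) (by omega) hk _ (hQ0 y.1),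
        inclusionMatrix_eq_zero (by omega)]
      simp
    have hsymm : ∀ x y, (Rᵀ * R) x y = (Rᵀ * R) y x := fun x y => by
      simp only [mul_apply, transpose_apply, mul_comm]
    ext ⟨j, a⟩ ⟨j', a'⟩
    rcases lt_trichotomy j j' with h | h | h
    · rw [hlt _ _ h, diagonal_apply_ne]
      rintro ⟨⟩
      exact lt_irrefl _ h
    · subst h
      rw [key, transpose_mul_gram (by omega) (by omega) hk _ (hQ0 j), inclusionMatrix_self,
        transpose_one, Matrix.one_mul, hQ1]
      by_cases ha : a = a'
      · subst ha
        simp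
      · rw [diagonal_apply_ne _ (by simpa using ha), Matrix.smul_apply, Matrix.one_apply_ne ha,
          smul_zero]
    · rw [hsymm, hlt _ _ h, diagonal_apply_ne]
      rintro ⟨⟩
      exact lt_irrefl _ h
  have hRA : ∀ i ≤ k, (inclusionMatrix α i k)ᵀ * inclusionMatrix α i k * R =
      R * diagonal fun x => (johnsonEigenvalue (Fintype.card α) k i x.1 : ℝ) := fun i hi => by
    ext K x
    have h := congrFun (congrFun (gram_inclusionMatrix_mul hi (by omega) hk (hQ0 x.1)) K) x.2
    have hd := mul_diagonal (fun x => (johnsonEigenvalue (Fintype.card α) k i x.1 : ℝ)) R K x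
    exact (h.trans (mul_comm _ _)).trans hd.symm
  refine ⟨e, R.submatrix id e.symm, ?_, fun i hi => ?_⟩
  · have h : (R.submatrix id e.symm)ᵀ * R.submatrix id e.symm = diagonal fun K =>
        ((Fintype.card α - (e.symm K).1 - (e.symm K).1).choose
          (Fintype.card α - k - (e.symm K).1) : ℝ) := by
      ext K K'
      have h := congrFun (congrFun hR (e.symm K)) (e.symm K')
      rw [diagonal_apply] at h ⊢
      simp only [e.symm.injective.eq_iff] at h
      exact h
    -- The Gram matrix of the lifts is diagonal with positive entries, so the square matrix of lifts
    -- is invertible.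
    have hu : IsUnit ((R.submatrix id e.symm)ᵀ * R.submatrix id e.symm) := by
      rw [h, Matrix.isUnit_iff_isUnit_det, det_diagonal, isUnit_iff_ne_zero, prod_ne_zero_iff]
      intro K _
      exact_mod_cast (Nat.choose_pos (by omega)).ne'
    rw [Matrix.isUnit_iff_isUnit_det] at hu ⊢
    rw [det_mul] at hu
    exact isUnit_of_mul_isUnit_right hu
  · ext K x
    have h := congrFun (congrFun (hRA i hi) K) (e.symm x)
    have hd := mul_diagonal (fun x => (johnsonEigenvalue (Fintype.card α) k i (e.symm x).1 : ℝ))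
      (R.submatrix id e.symm) K x
    exact (h.trans (mul_diagonal _ R K _)).trans hd.symm

/-! ### Spectral data read off a diagonalization -/

section
variable {n : Type*} [Fintype n] [DecidableEq n] {A P : Matrix n n ℝ} {d : n → ℝ}

theorem charpoly_of_mul_eq_mul_diagonal (hP : IsUnit P) (h : A * P = P * diagonal d) :
    A.charpoly = ∏ i, (Polynomial.X - Polynomial.C (d i)) := by
  obtain ⟨U, rfl⟩ := hP
  rw [← charpoly_diagonal, ← charpoly_units_conj U (diagonal d), ← h, Matrix.mul_assoc,
    ← coe_units_inv, Units.mul_inv, Matrix.mul_one]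

theorem rank_of_mul_eq_mul_diagonal (hP : IsUnit P) (h : A * P = P * diagonal d) :
    A.rank = #{i | d i ≠ 0} := by
  rw [Matrix.isUnit_iff_isUnit_det] at hP
  rw [← rank_mul_eq_left_of_isUnit_det P A hP, h, rank_mul_eq_right_of_isUnit_det P _ hP,
    rank_diagonal, Fintype.card_subtype]

theorem finrank_eigenspace_of_mul_eq_mul_diagonal (hP : IsUnit P) (h : A * P = P * diagonal d)
    (x : ℝ) :
    Module.finrank ℝ (Module.End.eigenspace (toLin' A) x) = #{i | d i = x} := by
  have h' : (A - x • 1) * P = P * diagonal fun i => d i - x := by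
    have : (diagonal fun i => d i - x) = diagonal d - x • (1 : Matrix n n ℝ) := by
      rw [← diagonal_one, ← diagonal_smul, diagonal_sub]
      simp
    rw [this, Matrix.sub_mul, Matrix.mul_sub, h]
    simp
  have hr := rank_of_mul_eq_mul_diagonal hP h'
  have hk := (toLin' (A - x • 1)).finrank_range_add_finrank_ker
  have hrk : Module.finrank ℝ (LinearMap.range (toLin' (A - x • 1))) = (A - x • 1).rank := by
    rw [Matrix.rank, Matrix.toLin'_apply']
  have he : Module.End.eigenspace (toLin' A) x = LinearMap.ker (toLin' (A - x • 1)) := by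
    rw [Module.End.eigenspace_def, map_sub, map_smul, toLin'_one]
    rfl
  have hc := card_filter_add_card_filter_not (s := (univ : Finset n)) (fun i => d i = x)
  simp only [sub_ne_zero] at hr
  rw [hrk, hr, Module.finrank_fintype_fun_eq_card] at hk
  rw [he]
  rw [card_univ] at hc
  simp only [ne_eq] at hk
  omega

end

/-! ### Expansion of the intersection matrix -/

/-- Binomial inversion: `C(m,i) C(i,ℓ) = C(m,ℓ) C(m-ℓ,i-ℓ)` reduces the sum to an alternating row
sum of Pascal's triangle. -/
theorem alternating_sum_choose_mul_choose {m s : ℕ} (ℓ : ℕ) (h : m ≤ s) :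
    ∑ i ∈ range (s + 1), (-1 : ℤ) ^ (i + ℓ) * i.choose ℓ * m.choose i =
      if m = ℓ then 1 else 0 := by
  rcases lt_or_ge m ℓ with hm | hm
  · rw [if_neg hm.ne]
    refine sum_eq_zero fun i _ => ?_
    rcases lt_or_ge i ℓ with hi | hi
    · simp [Nat.choose_eq_zero_of_lt hi]
    · simp [Nat.choose_eq_zero_of_lt (hm.trans_le hi)]
  · have hsub : range (m + 1) ⊆ range (s + 1) := range_subset_range.2 (by omega)
    rw [← sum_subset hsub fun i _ hi => by
      rw [mem_range, not_lt] at hi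
      simp [Nat.choose_eq_zero_of_lt (show m < i by omega)]]
    obtain ⟨r, rfl⟩ := Nat.exists_eq_add_of_le hm
    rw [show ℓ + r + 1 = ℓ + (r + 1) by omega, sum_range_add, sum_eq_zero, zero_add]
    · have hterm : ∀ i ∈ range (r + 1),
          (-1 : ℤ) ^ (ℓ + i + ℓ) * (ℓ + i).choose ℓ * (ℓ + r).choose (ℓ + i) =
            (ℓ + r).choose ℓ * ((-1) ^ i * r.choose i) := fun i _ => by
        have hc := Nat.choose_mul (n := ℓ + r) (k := ℓ + i) (s := ℓ) (by omega)
        rw [Nat.add_sub_cancel_left, Nat.add_sub_cancel_left] at hc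
        have hs : (-1 : ℤ) ^ (ℓ + i + ℓ) = (-1) ^ i := by
          rw [show ℓ + i + ℓ = i + 2 * ℓ by ring, pow_add, pow_mul]
          simp
        have hc' : ((ℓ + r).choose (ℓ + i) : ℤ) * (ℓ + i).choose ℓ =
            (ℓ + r).choose ℓ * r.choose i := by exact_mod_cast hc
        rw [hs]
        linear_combination (-1) ^ i * hc'
      rw [sum_congr rfl hterm, ← mul_sum, Int.alternating_sum_range_choose]
      by_cases hr : r = 0 <;> simp [hr]
    · intro i hi
      simp [Nat.choose_eq_zero_of_lt (mem_range.mp hi)]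

theorem intersectionMatrix_eq_sum {α : Type*} [Fintype α] [DecidableEq α] (s k ℓ : ℕ) :
    intersectionMatrix α s k ℓ = ∑ i ∈ range (s + 1), ((-1 : ℝ) ^ (i + ℓ) * i.choose ℓ) •
      ((inclusionMatrix α i s)ᵀ * inclusionMatrix α i k) := by
  ext S K
  rw [Matrix.sum_apply]
  simp only [Matrix.smul_apply, transpose_mul_inclusionMatrix_apply, smul_eq_mul]
  have hm : (S.1 ∩ K.1).card ≤ s := (card_le_card inter_subset_left).trans S.2.le
  have := congrArg (Int.cast : ℤ → ℝ) (alternating_sum_choose_mul_choose ℓ hm)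
  push_cast at this
  rw [this]
  rfl

theorem transpose_inclusionMatrix_mul_intersectionMatrix {α : Type*} [Fintype α] [DecidableEq α]
    (s k ℓ : ℕ) :
    (inclusionMatrix α s k)ᵀ * intersectionMatrix α s k ℓ =
      ∑ i ∈ range (s + 1), ((-1 : ℝ) ^ (i + ℓ) * i.choose ℓ * (k - i).choose (s - i)) •
        ((inclusionMatrix α i k)ᵀ * inclusionMatrix α i k) := by
  rw [intersectionMatrix_eq_sum, Matrix.mul_sum]
  refine sum_congr rfl fun i hi => ?_
  rw [Matrix.mul_smul, ← Matrix.mul_assoc, ← transpose_mul,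
    inclusionMatrix_mul k (Nat.le_of_lt_succ (mem_range.mp hi)), transpose_smul, Matrix.smul_mul,
    smul_smul]

/-! ### Comparison of the eigenvalues with `τ_j` -/

/-- The eigenvalue of `W_{sk}ᵀ U_{sk}^ℓ` on the `j`-th eigenspace of the Johnson scheme. -/
def intersectionEigenvalue (v s k ℓ j : ℕ) : ℤ :=
  ∑ i ∈ range (s + 1),
    (-1) ^ (i + ℓ) * i.choose ℓ * (k - i).choose (s - i) * johnsonEigenvalue v k i j

theorem intersectionEigenvalue_eq_zero {s j : ℕ} (v k ℓ : ℕ) (h : s < j) :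
    intersectionEigenvalue v s k ℓ j = 0 := by
  refine sum_eq_zero fun i hi => ?_
  rw [mem_range] at hi
  rw [johnsonEigenvalue, if_neg (by omega)]
  simp

theorem intBinom_natCast (n m : ℕ) : intBinom n m = n.choose m := by
  simp [intBinom, Ring.choose_natCast]

theorem intBinom_of_neg {m : ℤ} (n : ℤ) (h : m < 0) : intBinom n m = 0 :=
  if_neg h.not_ge

theorem intBinom_neg_natCast (r m : ℕ) :
    intBinom (-(r + 1 : ℕ)) m = (-1) ^ m * ((r + m).choose m : ℤ) := by
  rw [intBinom, if_pos (by positivity), Int.toNat_natCast, Ring.choose_neg,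
    show ((r + 1 : ℕ) : ℤ) + m - 1 = (r + m : ℕ) by push_cast; ring, Ring.choose_natCast,
    Units.smul_def]
  simp [Int.negOnePow_def]

theorem tauValue_eq_intersectionEigenvalue {v s k ℓ j : ℕ} (hj : j ≤ s) (hsk : s ≤ k)
    (hk : 2 * k ≤ v) : tauValue v s k ℓ j = intersectionEigenvalue v s k ℓ j := by
  -- For `i ≤ s` the upper entry is negative, and negating it produces `C(k-i, s-i)` with a sign.
  have hlast : ∀ i : ℕ, intBinom ((i : ℤ) - s - 1) ((k : ℤ) - s) =
      if i ≤ s then (-1) ^ (k - s) * ((k - i).choose (s - i) : ℤ) else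
        ((i - s - 1).choose (k - s) : ℤ) := fun i => by
    rw [← Nat.cast_sub hsk]
    split_ifs with hi
    · rw [show (i : ℤ) - s - 1 = -((s - i + 1 : ℕ) : ℤ) by omega, intBinom_neg_natCast,
        show s - i + (k - s) = k - i by omega, ← Nat.choose_symm (by omega),
        show k - i - (k - s) = s - i by omega]
    · rw [show (i : ℤ) - s - 1 = ((i - s - 1 : ℕ) : ℤ) by omega, intBinom_natCast]
  have hI : Icc (min j ℓ) k ⊆ range (k + 1) := fun i hi => by
    rw [mem_Icc] at hi
    rw [mem_range]
    omega
  rw [tauValue, intersectionEigenvalue, sum_subset hI, mul_sum]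
  · rw [← sum_subset (range_subset_range.2 (show s + 1 ≤ k + 1 by omega))]
    · refine sum_congr rfl fun i hi => ?_
      have his : i ≤ s := Nat.le_of_lt_succ (mem_range.mp hi)
      rw [hlast, if_pos his, intBinom_natCast, johnsonEigenvalue]
      split_ifs with hji
      · rw [← Nat.cast_sub (hji.trans (his.trans hsk)), ← Nat.cast_sub hji,
          ← Nat.cast_sub (his.trans hsk),
          show (v : ℤ) - j - i = ((v - i - j : ℕ) : ℤ) by omega]
        simp only [intBinom_natCast]
        have hs : (-1 : ℤ) ^ (k + s + ℓ) * (-1) ^ i * (-1) ^ (k - s) = (-1) ^ (i + ℓ) := by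
          rw [← pow_add, ← pow_add, show k + s + ℓ + i + (k - s) = i + ℓ + 2 * k by omega, pow_add,
            pow_mul]
          simp
        rw [← hs]
        push_cast
        ring
      · rw [intBinom_of_neg _ (show (i : ℤ) - j < 0 by omega)]
        simp
    -- For `s < i ≤ k` the last binomial vanishes because `0 ≤ i - s - 1 < k - s`.
    · intro i hik his
      rw [mem_range] at hik his
      rw [hlast, if_neg (by omega), Nat.choose_eq_zero_of_lt (by omega)]
      simp
  -- Indices below `min j ℓ` contribute nothing, since `C(i, ℓ) = 0`.
  · intro i hik hi
    rw [mem_range] at hik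
    rw [mem_Icc] at hi
    rw [intBinom_natCast, Nat.choose_eq_zero_of_lt (show i < ℓ by omega)]
    simp

/-! ### Multiplicities, ranks and the conclusion -/

theorem prod_sigma_levelMult {β M : Type*} [Fintype β] [CommMonoid M] {v k : ℕ}
    (e : (Σ j : Fin (k + 1), Fin (levelMult v j)) ≃ β) (f : ℕ → M) :
    ∏ x, f (e.symm x).1 = ∏ j ∈ range (k + 1), f j ^ levelMult v j := by
  rw [Equiv.prod_comp e.symm (fun y => f y.1), Fintype.prod_sigma]
  simp only [prod_const, card_univ, Fintype.card_fin]
  exact Fin.prod_univ_eq_prod_range (fun j => f j ^ levelMult v j) (k + 1)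

theorem card_sigma_levelMult {β : Type*} [Fintype β] {v k : ℕ}
    (e : (Σ j : Fin (k + 1), Fin (levelMult v j)) ≃ β) (p : ℕ → Prop) [DecidablePred p] :
    #{x | p (e.symm x).1} = ∑ j ∈ range (k + 1) with p j, levelMult v j := by
  rw [card_filter, Equiv.sum_comp e.symm (fun y => if p y.1 then 1 else 0), Fintype.sum_sigma,
    sum_filter]
  rw [← Fin.sum_univ_eq_sum_range (fun j => if p j then levelMult v j else 0) (k + 1)]
  refine sum_congr rfl fun j _ => ?_
  split_ifs <;> simp

theorem sum_levelMult_Ico {v s k : ℕ} (hsk : s ≤ k) (hk : 2 * k ≤ v) :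
    ∑ j ∈ Ico (s + 1) (k + 1), levelMult v j = v.choose k - v.choose s := by
  have h := sum_range_add_sum_Ico (levelMult v) (show s + 1 ≤ k + 1 by omega)
  rw [sum_levelMult hk, sum_levelMult (show 2 * s ≤ v by omega)] at h
  omega

theorem rank_inclusionMatrix {α : Type*} [Fintype α] [DecidableEq α] {v s k : ℕ}
    (hv : Fintype.card α = v) (hsk : s ≤ k) (hk : 2 * k ≤ v) :
    (inclusionMatrix α s k).rank = v.choose s := by
  obtain ⟨e, P, hP, h⟩ := exists_johnson_diagonalization hv hk
  rw [← rank_transpose_mul_self, rank_of_mul_eq_mul_diagonal hP (h s hsk),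
    card_sigma_levelMult e (fun j => (johnsonEigenvalue v k s j : ℝ) ≠ 0),
    ← sum_levelMult (show 2 * s ≤ v by omega)]
  congr 1
  ext j
  simp only [mem_filter, mem_range, johnsonEigenvalue, Nat.cast_ne_zero]
  split_ifs with hj
  · have : (k - j).choose (s - j) * (v - s - j).choose (k - s) ≠ 0 :=
      (Nat.mul_pos (Nat.choose_pos (by omega)) (Nat.choose_pos (by omega))).ne'
    simp only [this, ne_eq, not_false_eq_true, and_true]
    omega
  · simp only [ne_eq, not_true_eq_false, and_false, false_iff]
    omega

/-- `W_{sk}` has full row rank, so `W_{sk} W_{sk}ᵀ` is invertible and left multiplication by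
`W_{sk}ᵀ` loses no rank. -/
theorem rank_transpose_inclusionMatrix_mul {α ι : Type*} [Fintype α] [DecidableEq α] [Fintype ι]
    {v s k : ℕ} (hv : Fintype.card α = v) (hsk : s ≤ k) (hk : 2 * k ≤ v)
    (B : Matrix (SubsetsOfCard α s) ι ℝ) :
    ((inclusionMatrix α s k)ᵀ * B).rank = B.rank := by
  have hr : (inclusionMatrix α s k * (inclusionMatrix α s k)ᵀ).rank =
      Fintype.card (SubsetsOfCard α s) := by
    rw [rank_self_mul_transpose, rank_inclusionMatrix hv hsk hk, card_subsetsOfCard, hv]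
  have hu : IsUnit (inclusionMatrix α s k * (inclusionMatrix α s k)ᵀ).det := by
    rw [← Matrix.isUnit_iff_isUnit_det, ← Matrix.mulVec_surjective_iff_isUnit]
    have : LinearMap.range (inclusionMatrix α s k * (inclusionMatrix α s k)ᵀ).mulVecLin = ⊤ := by
      apply Submodule.eq_top_of_finrank_eq
      rw [Module.finrank_fintype_fun_eq_card]
      exact hr
    exact LinearMap.range_eq_top.mp this
  refine le_antisymm (rank_mul_le_right _ _) ?_
  rw [← rank_mul_eq_right_of_isUnit_det _ B hu, Matrix.mul_assoc]
  exact rank_mul_le_right _ _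

theorem mainTheorem5 {α : Type*} [Fintype α] [DecidableEq α] (v s k ℓ : ℕ)
    (hv : Fintype.card α = v) (hsk : s ≤ k) (hkv : 2 * k ≤ v) :
    ((inclusionMatrix α s k).transpose * intersectionMatrix α s k ℓ).charpoly =
        (∏ j ∈ Finset.range (s + 1),
          (Polynomial.X - Polynomial.C (tauValue v s k ℓ j : ℝ)) ^ levelMult v j) *
          Polynomial.X ^ (v.choose k - v.choose s) ∧
    (∀ x : ℝ,
      Module.finrank ℝ (Module.End.eigenspace (Matrix.toLin'
          ((inclusionMatrix α s k).transpose * intersectionMatrix α s k ℓ)) x) =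
        (∑ j ∈ Finset.range (s + 1) with (tauValue v s k ℓ j : ℝ) = x, levelMult v j) +
          if x = 0 then v.choose k - v.choose s else 0) ∧
    (intersectionMatrix α s k ℓ).rank =
      ∑ j ∈ Finset.range (s + 1) with tauValue v s k ℓ j ≠ 0, levelMult v j := by
  obtain ⟨e, P, hP, h⟩ := exists_johnson_diagonalization hv hkv
  have hA : (inclusionMatrix α s k)ᵀ * intersectionMatrix α s k ℓ * P =
      P * diagonal fun K => (intersectionEigenvalue v s k ℓ (e.symm K).1 : ℝ) := by
    rw [transpose_inclusionMatrix_mul_intersectionMatrix, Matrix.sum_mul]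
    ext K K'
    rw [Matrix.sum_apply, mul_diagonal, intersectionEigenvalue]
    push_cast
    rw [mul_sum]
    refine sum_congr rfl fun i hi => ?_
    rw [mem_range] at hi
    rw [Matrix.smul_mul, h i (by omega), Matrix.smul_apply, mul_diagonal, smul_eq_mul]
    ring
  have hτ : ∀ j ∈ range (s + 1), intersectionEigenvalue v s k ℓ j = tauValue v s k ℓ j :=
    fun j hj => (tauValue_eq_intersectionEigenvalue (Nat.le_of_lt_succ (mem_range.mp hj))
      hsk hkv).symm
  have h0 : ∀ j ∈ Ico (s + 1) (k + 1), intersectionEigenvalue v s k ℓ j = 0 :=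
    fun j hj => intersectionEigenvalue_eq_zero v k ℓ (mem_Ico.mp hj).1
  have hsk' : s + 1 ≤ k + 1 := by omega
  refine ⟨?_, fun x => ?_, ?_⟩
  · rw [charpoly_of_mul_eq_mul_diagonal hP hA, prod_sigma_levelMult e (fun j =>
      Polynomial.X - Polynomial.C (intersectionEigenvalue v s k ℓ j : ℝ)),
      ← prod_range_mul_prod_Ico _ hsk', ← sum_levelMult_Ico hsk hkv, ← prod_pow_eq_pow_sum]
    congr 1
    · exact prod_congr rfl fun j hj => by rw [hτ j hj]
    · exact prod_congr rfl fun j hj => by simp [h0 j hj]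
  · rw [finrank_eigenspace_of_mul_eq_mul_diagonal hP hA,
      card_sigma_levelMult e (fun j => (intersectionEigenvalue v s k ℓ j : ℝ) = x),
      sum_filter, sum_filter, ← sum_range_add_sum_Ico _ hsk']
    congr 1
    · exact sum_congr rfl fun j hj => by rw [hτ j hj]
    · rw [← sum_levelMult_Ico hsk hkv]
      split_ifs with hx
      · exact sum_congr rfl fun j hj => by simp [h0 j hj, hx]
      · exact sum_eq_zero fun j hj => by simp [h0 j hj, Ne.symm hx]
  · rw [← rank_transpose_inclusionMatrix_mul hv hsk hkv, rank_of_mul_eq_mul_diagonal hP hA,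
      card_sigma_levelMult e (fun j => (intersectionEigenvalue v s k ℓ j : ℝ) ≠ 0),
      sum_filter, sum_filter, ← sum_range_add_sum_Ico _ hsk',
      sum_eq_zero (s := Ico _ _) fun j hj => by simp [h0 j hj], add_zero]
    exact sum_congr rfl fun j hj => by simp [hτ j hj]
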